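/- Let $d\ge 0$ and let $G$ be a graph (loops and multiple edges allowed) with cofinite free $\mathbb Z^d$-symmetry: $\mathbb Z^d$ acts by automorphisms on $G$, freely on its vertices and on its edges, with finitely many vertex orbits and finitely many edge orbits. Write the action additively, and choose representatives $v_1,\dots,v_n$ of the vertex orbits, one for each orbit. The Laplacian matrix of $G$ is the $n\times n$ matrix $L=D-A$ over $\mathbb Z[x_1^{\pm1},\dots,x_d^{\pm1}]$, where $D$ is the diagonal matrix of the degrees of $v_1,\dots,v_n$ and $A_{i,j}$ is the sum of the monomials $x^{\mathbf s}=x_1^{s_1}\cdots x_d^{s_d}$, one for each edge of $G$ from $v_i$ to $\mathbf s+v_j$, $\mathbf s\in\mathbb Z^d$; loops of $G$ are ignored in both $D$ and $A$. The Laplacian polynomial of $G$ is $\Delta=\det L$ (another choice of representatives changes it at most by a unit). For a nonzero Laurent polynomial $f$, its logarithmic Mahler measure is $$m(f)=\int_{[0,1]^d}\log\bigl|f(e^{2\pi i\theta_1},\dots,e^{2\pi i\theta_d})\bigr|\,d\theta .$$ Then, whenever $\Delta\neq 0$, the integral defining $m(\Delta)$ converges absolutely, and $$m(\Delta)\neq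 0\quad\Longrightarrow\quad m(\Delta)\ \ge\ \log 2 .$$ The bound is attained: the graph with vertex set $\mathbb Z$ and with exactly two edges joining $k$ and $k+1$ for every $k\in\mathbb Z$ (and no other edges), with $\mathbb Z$ acting by translation, has cofinite free $\mathbb Z$-symmetry, and its Laplacian polynomial $\Delta$ satisfies $m(\Delta)=\log 2$. -/

import Mathlib

open MeasureTheory

noncomputable section

namespace PeriodicGraph

/-- The Laurent polynomial ring `ℤ[x₁^{±1}, …, x_d^{±1}]`, i.e. the integral group ring of `ℤ^d`;
the monomial `x^s` is `AddMonoidAlgebra.single s 1`. -/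
abbrev LaurentRing (d : ℕ) : Type := AddMonoidAlgebra ℤ (Fin d → ℤ)

/-- The value of a Laurent polynomial at a point `z` with nonzero coordinates. -/
def evalAt {d : ℕ} (z : Fin d → ℂ) (f : LaurentRing d) : ℂ :=
  f.coeff.sum fun s c => (c : ℂ) * ∏ i, z i ^ s i

/-- The function `θ ↦ log |f(e^{2πiθ₁}, …, e^{2πiθ_d})|`. -/
def logAbsOnTorus {d : ℕ} (f : LaurentRing d) (θ : Fin d → ℝ) : ℝ :=
  Real.log ‖evalAt (fun i => Complex.exp (2 * Real.pi * Complex.I * (θ i : ℂ))) f‖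

/-- The logarithmic Mahler measure of a (nonzero) Laurent polynomial: the integral of
`log |f(e^{2πiθ₁}, …, e^{2πiθ_d})|` over the unit cube `[0,1]^d`. -/
def logMahler {d : ℕ} (f : LaurentRing d) : ℝ :=
  ∫ θ in Set.Icc (0 : Fin d → ℝ) 1, logAbsOnTorus f θ

variable {α β : Type*}

/-- `G` is a multigraph (loops and multiple edges allowed) on which `ℤ^d` acts freely by
automorphisms, with finite quotient graph. The action is given on the ambient types of vertices
and edges, and only its restriction to the vertices and edges of `G` matters (every action on the
vertex set and the edge set extends to the ambient types, by fixing all other points). -/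
structure HasCofiniteFreeSymmetry (d : ℕ) [AddAction (Fin d → ℤ) α] [AddAction (Fin d → ℤ) β]
    (G : Graph α β) : Prop where
  mem_vertexSet_iff : ∀ (s : Fin d → ℤ) (x : α), s +ᵥ x ∈ G.vertexSet ↔ x ∈ G.vertexSet
  isLink_iff : ∀ (s : Fin d → ℤ) (e : β) (x y : α),
    G.IsLink (s +ᵥ e) (s +ᵥ x) (s +ᵥ y) ↔ G.IsLink e x y
  free_vertices : ∀ (s : Fin d → ℤ), ∀ x ∈ G.vertexSet, s +ᵥ x = x → s = 0
  free_edges : ∀ (s : Fin d → ℤ), ∀ e ∈ G.edgeSet, s +ᵥ e = e → s = 0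
  finite_vertex_orbits : (AddAction.orbit (Fin d → ℤ) '' G.vertexSet).Finite
  finite_edge_orbits : (AddAction.orbit (Fin d → ℤ) '' G.edgeSet).Finite

/-- `v₁, …, v_n` contains exactly one vertex of every vertex orbit of `G`. -/
structure IsOrbitRepresentatives (d : ℕ) [AddAction (Fin d → ℤ) α] (G : Graph α β) {n : ℕ}
    (v : Fin n → α) : Prop where
  mem : ∀ i, v i ∈ G.vertexSet
  existsUnique : ∀ x ∈ G.vertexSet, ∃! i, x ∈ AddAction.orbit (Fin d → ℤ) (v i)

/-- The degree of a vertex, loops being ignored. -/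
def degree (G : Graph α β) (x : α) : ℕ := {e | G.IsNonloopAt e x}.ncard

/-- The number of edges joining `x` and `y`, loops being ignored. -/
def edgeCount (G : Graph α β) (x y : α) : ℕ := {e | G.IsLink e x y ∧ x ≠ y}.ncard

/-- The Laplacian matrix `D - A` of `G` with respect to the orbit representatives `v`: the matrix
`D` is the diagonal matrix of degrees of the `v i`, and `A i j` is the sum of the monomials `x^s`,
one for each (non-loop) edge from `v i` to `s +ᵥ v j`. -/
def laplacianMatrix (d : ℕ) [AddAction (Fin d → ℤ) α] (G : Graph α β) {n : ℕ} (v : Fin n → α) :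
    Matrix (Fin n) (Fin n) (LaurentRing d) :=
  Matrix.diagonal (fun i => (degree G (v i) : LaurentRing d)) -
    Matrix.of fun i j => ∑ᶠ s : Fin d → ℤ,
      AddMonoidAlgebra.single s (edgeCount G (v i) (s +ᵥ v j) : ℤ)

/-- The Laplacian polynomial `Δ` of `G`, the determinant of the Laplacian matrix. -/
def laplacianPolynomial (d : ℕ) [AddAction (Fin d → ℤ) α] (G : Graph α β) {n : ℕ}
    (v : Fin n → α) : LaurentRing d :=
  (laplacianMatrix d G v).det

/-- The edges of the doubled line: two copies of the edge from `base` to `base + 1`, for every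
`base` in `ℤ = ℤ¹`. -/
@[ext]
structure DoubledLineEdge : Type where
  base : Fin 1 → ℤ
  copy : Bool

/-- `ℤ` acts on the edges of the doubled line by translation. -/
instance : AddAction (Fin 1 → ℤ) DoubledLineEdge where
  vadd s e := ⟨s + e.base, e.copy⟩
  zero_vadd e := DoubledLineEdge.ext (zero_add e.base) rfl
  add_vadd s t e := DoubledLineEdge.ext (add_assoc s t e.base) rfl

/-- The graph `ℤ` (vertex set `ℤ = ℤ¹`, consecutive integers adjacent) with every edge doubled.
The group `ℤ` acts on its vertices by translation. -/
def doubledLine : Graph (Fin 1 → ℤ) DoubledLineEdge where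
  vertexSet := Set.univ
  IsLink e x y := (x = e.base ∧ y = e.base + 1) ∨ (x = e.base + 1 ∧ y = e.base)
  isLink_symm := fun _ _ => ⟨fun _ _ h => h.elim (fun h => Or.inr ⟨h.2, h.1⟩)
    (fun h => Or.inl ⟨h.2, h.1⟩)⟩
  eq_or_eq_of_isLink_of_isLink := by
    rintro e x y v w (⟨rfl, rfl⟩ | ⟨rfl, rfl⟩) (⟨rfl, rfl⟩ | ⟨rfl, rfl⟩) <;> simp
  left_mem_of_isLink := fun _ _ _ _ => Set.mem_univ _

end PeriodicGraph

end

open MeasureTheory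

noncomputable section

namespace PeriodicGraph

/-! The Laplacian matrix factors as `L = B B^*`. Here `B` is the incidence matrix of the quotient
graph without the loops of `G`: the column of an edge is a difference of two monomial vectors. The
star is transposition together with `xᵢ ↦ xᵢ⁻¹`, which is complex conjugation on the torus. By
Cauchy–Binet, `|Δ|` on the torus is the sum of `|b|²` over the maximal minors `b` of `B`, one for
each `n`-element set of columns.

Each maximal minor is zero or, up to sign, a product of monomials and binomials `x^s - x^t` with `s
≠ t` (`det_eq_zero_or_isMonomialBinomialProduct`). Clearing a column by a row operation amounts to
contracting an edge and keeps the shape of the other columns. Such products have logarithmic Mahler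
measure zero: `|x^s - x^t| = |x^(s-t) - 1|`, the character `x^(s-t)` carries Haar measure to Haar
measure, and Jensen's formula gives `m(z - 1) = 0`.

If only one minor `b` is nonzero, then `|Δ| = |b|²` and `m(Δ) = 0`. If two minors `b`, `c` from
different column sets are nonzero, then `|Δ| ≥ |b|² + |c|² ≥ 2|b||c|`, hence `m(Δ) ≥ log 2`. The
lower bound also gives absolute convergence, since `log |Δ|` is bounded above. -/

/-- The Cauchy–Binet formula, summed over all functions instead of subsets. -/
theorem factorial_mul_det_mul {R ι E : Type*} [CommRing R] [Fintype ι] [DecidableEq ι] [Fintype E]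
    (B : Matrix ι E R) (C : Matrix E ι R) :
    ((Fintype.card ι).factorial : R) * (B * C).det =
      ∑ f : ι → E, (B.submatrix id f).det * (C.submatrix f id).det := by
  classical
  -- The columns of `B * C` are combinations of columns of `B`; multilinearity expands the
  -- determinant over all choices `f` of one column for each position.
  have expand : (B * C).det = ∑ f : ι → E, (B.submatrix id f).det * ∏ i, C (f i) i := by
    have hrow : (B * C).transpose = fun i => ∑ e, C e i • B.transpose e := by
      ext i j
      simp [Matrix.mul_apply, Finset.sum_apply, mul_comm]
    rw [← Matrix.det_transpose, hrow]
    have h := (Matrix.detRowAlternating (n := ι) (R := R)).toMultilinearMap.map_sum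
      (fun (i : ι) (e : E) => C e i • B.transpose e)
    refine h.trans (Finset.sum_congr rfl fun f _ => ?_)
    refine (MultilinearMap.map_smul_univ _ (fun i => C (f i) i)
      (fun i => B.transpose (f i))).trans ?_
    rw [smul_eq_mul, mul_comm, ← Matrix.det_transpose]
    rfl
  -- Reindexing by `f ↦ f ∘ σ` costs the sign of `σ` in the minor of `B`. Summing over all `σ` then
  -- assembles the minor of `C` and produces the factorial.
  have permuted : ∀ σ : Equiv.Perm ι, (B * C).det =
      ∑ f : ι → E, (B.submatrix id f).det *
        ((Equiv.Perm.sign σ : ℤ) * ∏ i, C (f (σ i)) i) := by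
    intro σ
    rw [expand, ← Equiv.sum_comp (Equiv.arrowCongr σ.symm (Equiv.refl E))]
    refine Finset.sum_congr rfl fun f _ => ?_
    have : (B.submatrix id f).submatrix id σ = B.submatrix id (f ∘ σ) := rfl
    have h2 : (Equiv.arrowCongr σ.symm (Equiv.refl E)) f = f ∘ σ := by ext; simp
    rw [h2, ← this, Matrix.det_permute']
    simp only [Function.comp_apply]
    ring
  have hcard : ((Fintype.card ι).factorial : R) * (B * C).det =
      ∑ _σ : Equiv.Perm ι, (B * C).det := by
    rw [Finset.sum_const, Finset.card_univ, Fintype.card_perm, nsmul_eq_mul]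
  rw [hcard, Finset.sum_congr rfl fun σ _ => permuted σ, Finset.sum_comm]
  refine Finset.sum_congr rfl fun f _ => ?_
  rw [← Finset.mul_sum, Matrix.det_apply' (C.submatrix f id)]
  rfl

/-! ### Minors of a monomial incidence matrix -/

/-- The monomial `x^s`. -/
abbrev monomial {d : ℕ} (s : Fin d → ℤ) : LaurentRing d := AddMonoidAlgebra.single s 1

/-- A column vector that is zero or has a single nonzero entry, a monomial. -/
def IsHalfColumn {d n : ℕ} (u : Fin n → LaurentRing d) : Prop :=
  u = 0 ∨ ∃ (i : Fin n) (s : Fin d → ℤ), u = Pi.single i (monomial s)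

/-- Adding `c k` times row `i` to the row `k ≠ i` and then deleting row `i`. -/
def eliminateRow {R : Type*} [CommRing R] {n : ℕ} (i : Fin (n + 1)) (c : Fin n → R)
    (u : Fin (n + 1) → R) (k : Fin n) : R :=
  u (i.succAbove k) + c k * u i

/-- The row operations preserve the determinant and leave column `0` with its entry in row `i` only,
so the Laplace expansion along that column has one term. -/
theorem det_eq_mul_det_eliminateRow {R : Type*} [CommRing R] {n : ℕ}
    (M : Matrix (Fin (n + 1)) (Fin (n + 1)) R) (i : Fin (n + 1)) (c : Fin n → R)
    (h : eliminateRow i c (fun k => M k 0) = 0) :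
    M.det = (-1) ^ (i : ℕ) * M i 0 *
      (Matrix.of fun k l : Fin n => eliminateRow i c (fun r => M r l.succ) k).det := by
  set c' : Fin (n + 1) → R := i.insertNth 0 c with hc'
  set N : Matrix (Fin (n + 1)) (Fin (n + 1)) R := Matrix.of fun k l => M k l + c' k * M i l with hN
  have hdet : N.det = M.det :=
    Matrix.det_eq_of_forall_row_eq_smul_add_const c' i (by simp [hc']) fun _ _ => rfl
  have hzero : ∀ k, k ≠ i → N k 0 = 0 := by
    intro k hk
    obtain ⟨k, rfl⟩ := Fin.exists_succAbove_eq hk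
    have := congrFun h k
    simpa [hN, hc', eliminateRow] using this
  rw [← hdet, Matrix.det_succ_column N 0, Finset.sum_eq_single i]
  · have h1 : N i 0 = M i 0 := by simp [hN, hc']
    have h2 : N.submatrix i.succAbove (Fin.succAbove 0) =
        Matrix.of fun k l : Fin n => eliminateRow i c (fun r => M r l.succ) k := by
      ext k l
      simp [hN, hc', eliminateRow]
    rw [h1, h2]
    simp
  · intro k _ hk
    rw [hzero k hk]
    ring
  · simp

/-- A monomial outside the pivot row stays in place. One in the pivot row moves to the single row
where `c` is nonzero, multiplied by a monomial, or disappears if `c = 0`. -/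
theorem IsHalfColumn.eliminateRow {d n : ℕ} {u : Fin (n + 1) → LaurentRing d}
    (hu : IsHalfColumn u) (i : Fin (n + 1)) {c : Fin n → LaurentRing d} (hc : IsHalfColumn c) :
    IsHalfColumn (eliminateRow i c u) := by
  rcases hu with rfl | ⟨l, s, rfl⟩
  · left
    ext1 k
    simp [PeriodicGraph.eliminateRow]
  · rcases eq_or_ne l i with rfl | hl
    · rcases hc with rfl | ⟨j, t, rfl⟩
      · left
        ext1 k
        simp [PeriodicGraph.eliminateRow]
      · right
        refine ⟨j, t + s, ?_⟩
        ext1 k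
        rcases eq_or_ne k j with rfl | hk
        · simp [PeriodicGraph.eliminateRow, AddMonoidAlgebra.single_mul_single]
        · simp [PeriodicGraph.eliminateRow, hk]
    · right
      obtain ⟨j, rfl⟩ := Fin.exists_succAbove_eq hl
      refine ⟨j, s, ?_⟩
      ext1 k
      rcases eq_or_ne k j with rfl | hk
      · simp [PeriodicGraph.eliminateRow]
      · simp [PeriodicGraph.eliminateRow, hk, hl.symm]

theorem eliminateRow_sub {R : Type*} [CommRing R] {n : ℕ} (i : Fin (n + 1)) (c : Fin n → R)
    (u w : Fin (n + 1) → R) : eliminateRow i c (u - w) = eliminateRow i c u - eliminateRow i c w := by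
  ext k
  simp only [eliminateRow, Pi.sub_apply]
  ring

/-- Products of signed monomials and of differences of two distinct monomials. -/
inductive IsMonomialBinomialProduct {d : ℕ} : LaurentRing d → Prop
  | single (s : Fin d → ℤ) : IsMonomialBinomialProduct (monomial s)
  | single_sub_single (s t : Fin d → ℤ) (h : s ≠ t) :
      IsMonomialBinomialProduct (monomial s - monomial t)
  | neg {f : LaurentRing d} : IsMonomialBinomialProduct f → IsMonomialBinomialProduct (-f)
  | mul {f g : LaurentRing d} : IsMonomialBinomialProduct f → IsMonomialBinomialProduct g →
      IsMonomialBinomialProduct (f * g)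

/-- If every column is the difference of two half columns, the determinant is zero or a product of
signed monomials and binomials. -/
theorem det_eq_zero_or_isMonomialBinomialProduct {d : ℕ} : ∀ {n : ℕ}
    (M : Matrix (Fin n) (Fin n) (LaurentRing d)),
    (∀ l, ∃ u w, IsHalfColumn u ∧ IsHalfColumn w ∧ (fun k => M k l) = u - w) →
    M.det = 0 ∨ IsMonomialBinomialProduct M.det := by
  intro n
  induction n with
  | zero =>
    intro M _
    right
    rw [Matrix.det_fin_zero, AddMonoidAlgebra.one_def]
    exact .single 0
  | succ n ih =>
    intro M hM
    -- It remains to find, in each case, a pivot row `i` and a half column `c` of multipliers that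
    -- clear the rest of column `0`.
    have step : ∀ (i : Fin (n + 1)) (c : Fin n → LaurentRing d), IsHalfColumn c →
        eliminateRow i c (fun k => M k 0) = 0 →
        (M i 0 = 0 ∨ IsMonomialBinomialProduct (M i 0)) →
        M.det = 0 ∨ IsMonomialBinomialProduct M.det := by
      intro i c hc h0 hpivot
      rw [det_eq_mul_det_eliminateRow M i c h0]
      rcases hpivot with hpivot | hpivot
      · left
        rw [hpivot]
        ring
      have hsign : IsMonomialBinomialProduct ((-1) ^ (i : ℕ) * M i 0) := by
        rcases neg_one_pow_eq_or (LaurentRing d) (i : ℕ) with h | h <;> rw [h]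
        · rwa [one_mul]
        · rw [neg_one_mul]
          exact hpivot.neg
      rcases ih (Matrix.of fun k l : Fin n => eliminateRow i c (fun r => M r l.succ) k) (by
        intro l
        obtain ⟨u, w, hu, hw, h⟩ := hM l.succ
        refine ⟨_, _, hu.eliminateRow i hc, hw.eliminateRow i hc, ?_⟩
        rw [← eliminateRow_sub, ← h]
        rfl) with h | h
      · left
        rw [h, mul_zero]
      · right
        exact hsign.mul h
    obtain ⟨u, w, hu, hw, h⟩ := hM 0
    have hentry : ∀ k, M k 0 = u k - w k := fun k => congrFun h k
    have hzero : IsHalfColumn (0 : Fin n → LaurentRing d) := .inl rfl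
    rcases hu with rfl | ⟨i, s, rfl⟩ <;> rcases hw with rfl | ⟨j, t, rfl⟩
    · left
      exact Matrix.det_eq_zero_of_column_eq_zero 0 fun k => by simp [hentry]
    · refine step j 0 hzero ?_ (.inr ?_)
      · ext1 k
        simp [eliminateRow, hentry]
      · simpa [hentry] using (IsMonomialBinomialProduct.single t).neg
    · refine step i 0 hzero ?_ (.inr ?_)
      · ext1 k
        simp [eliminateRow, hentry]
      · simpa [hentry] using IsMonomialBinomialProduct.single s
    -- Both monomials in the same row: the pivot is `x^s - x^t`. This is the only source of binomial
    -- factors.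
    · rcases eq_or_ne j i with rfl | hij
      · refine step j 0 hzero ?_ ?_
        · ext1 k
          simp [eliminateRow, hentry]
        · rcases eq_or_ne s t with rfl | hst
          · left
            simp [hentry]
          · right
            simpa [hentry] using IsMonomialBinomialProduct.single_sub_single s t hst
      · obtain ⟨j, rfl⟩ := Fin.exists_succAbove_eq hij
        -- The column has `x^s` in row `i` and `-x^t` in row `j`; adding `x^(t-s)` times row `i`
        -- cancels the latter.
        refine step i (Pi.single j (monomial (t - s))) (.inr ⟨j, t - s, rfl⟩) ?_
          (.inr ?_)
        · ext1 k
          rcases eq_or_ne k j with rfl | hk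
          · simp [eliminateRow, hentry, hij.symm, hij, AddMonoidAlgebra.single_mul_single]
          · simp [eliminateRow, hentry, hij.symm, hk]
        · simpa [hentry, hij.symm, hij] using IsMonomialBinomialProduct.single s

/-! ### Evaluation on the torus -/

/-- The linear form `θ ↦ ∑ᵢ sᵢ θᵢ`. -/
def phase {d : ℕ} (s : Fin d → ℤ) (θ : Fin d → ℝ) : ℝ := ∑ i, (s i : ℝ) * θ i

theorem phase_add {d : ℕ} (s t : Fin d → ℤ) (θ : Fin d → ℝ) :
    phase (s + t) θ = phase s θ + phase t θ := by
  simp [phase, add_mul, Finset.sum_add_distrib]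

theorem phase_neg {d : ℕ} (s : Fin d → ℤ) (θ : Fin d → ℝ) : phase (-s) θ = -phase s θ := by
  simp [phase]

/-- Evaluation of a Laurent polynomial at `(e^{2πiθ₁}, …, e^{2πiθ_d})`, as a ring homomorphism. -/
def evalTorus {d : ℕ} (θ : Fin d → ℝ) : LaurentRing d →+* ℂ :=
  (AddMonoidAlgebra.lift ℤ ℂ (Fin d → ℤ)
    { toFun := fun s => Complex.exp (2 * Real.pi * Complex.I * phase s.toAdd θ)
      map_one' := by simp [phase]
      map_mul' := fun s t => by
        rw [← Complex.exp_add, toAdd_mul, phase_add]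
        push_cast
        ring_nf } : LaurentRing d →ₐ[ℤ] ℂ).toRingHom

theorem evalTorus_single {d : ℕ} (θ : Fin d → ℝ) (s : Fin d → ℤ) (c : ℤ) :
    evalTorus θ (AddMonoidAlgebra.single s c) =
      c * Complex.exp (2 * Real.pi * Complex.I * phase s θ) := by
  change AddMonoidAlgebra.lift ℤ ℂ (Fin d → ℤ) _ _ = _
  rw [AddMonoidAlgebra.lift_single, zsmul_eq_mul]
  rfl

theorem evalTorus_eq_sum {d : ℕ} (θ : Fin d → ℝ) (f : LaurentRing d) :
    evalTorus θ f = f.coeff.sum fun s c => c * Complex.exp (2 * Real.pi * Complex.I * phase s θ) := by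
  change AddMonoidAlgebra.lift ℤ ℂ (Fin d → ℤ) _ _ = _
  rw [AddMonoidAlgebra.lift_apply]
  simp only [zsmul_eq_mul]
  rfl

theorem evalAt_eq_evalTorus {d : ℕ} (θ : Fin d → ℝ) (f : LaurentRing d) :
    evalAt (fun i => Complex.exp (2 * Real.pi * Complex.I * (θ i : ℂ))) f = evalTorus θ f := by
  rw [evalTorus_eq_sum, evalAt]
  congr! 4 with s c
  simp only [← Complex.exp_int_mul, ← Complex.exp_sum, phase]
  congr 1
  push_cast
  rw [Finset.mul_sum]
  exact Finset.sum_congr rfl fun i _ => by ring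

theorem logAbsOnTorus_eq {d : ℕ} (f : LaurentRing d) (θ : Fin d → ℝ) :
    logAbsOnTorus f θ = Real.log ‖evalTorus θ f‖ := by
  rw [logAbsOnTorus, evalAt_eq_evalTorus]

theorem continuous_evalTorus {d : ℕ} (f : LaurentRing d) :
    Continuous fun θ : Fin d → ℝ => evalTorus θ f := by
  simp only [evalTorus_eq_sum, Finsupp.sum, phase]
  fun_prop

theorem measurable_logAbsOnTorus {d : ℕ} (f : LaurentRing d) : Measurable (logAbsOnTorus f) := by
  have : logAbsOnTorus f = fun θ => Real.log ‖evalTorus θ f‖ := funext (logAbsOnTorus_eq f)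
  rw [this]
  exact Real.measurable_log.comp (continuous_evalTorus f).norm.measurable

theorem norm_evalTorus_monomial {d : ℕ} (θ : Fin d → ℝ) (s : Fin d → ℤ) :
    ‖evalTorus θ (monomial s)‖ = 1 := by
  rw [evalTorus_single, Int.cast_one, one_mul,
    show 2 * Real.pi * Complex.I * (phase s θ : ℂ) =
      ((2 * Real.pi * phase s θ : ℝ) : ℂ) * Complex.I by push_cast; ring,
    Complex.norm_exp_ofReal_mul_I]

/-- The involution `xᵢ ↦ xᵢ⁻¹` of the ring of Laurent polynomials. -/
def inversion (d : ℕ) : LaurentRing d →+* LaurentRing d :=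
  AddMonoidAlgebra.mapDomainRingHom ℤ (negAddMonoidHom : (Fin d → ℤ) →+ (Fin d → ℤ))

theorem inversion_single {d : ℕ} (s : Fin d → ℤ) (c : ℤ) :
    inversion d (AddMonoidAlgebra.single s c) = AddMonoidAlgebra.single (-s) c := by
  simp [inversion]

theorem evalTorus_inversion {d : ℕ} (θ : Fin d → ℝ) (f : LaurentRing d) :
    evalTorus θ (inversion d f) = starRingEnd ℂ (evalTorus θ f) := by
  induction f using AddMonoidAlgebra.induction_linear with
  | zero => simp
  | add f g hf hg => simp [hf, hg]
  | single s c =>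
    rw [inversion_single, evalTorus_single, evalTorus_single, map_mul, ← Complex.exp_conj, phase_neg]
    simp [Complex.conj_ofNat]

theorem evalTorus_mul_inversion {d : ℕ} (θ : Fin d → ℝ) (f : LaurentRing d) :
    evalTorus θ (f * inversion d f) = ((‖evalTorus θ f‖ ^ 2 : ℝ) : ℂ) := by
  rw [map_mul, evalTorus_inversion, Complex.mul_conj, Complex.normSq_eq_norm_sq]

/-! ### Laurent polynomials of logarithmic Mahler measure zero -/

/-- The unit cube with Lebesgue measure. -/
abbrev cubeMeasure (d : ℕ) : Measure (Fin d → ℝ) := volume.restrict (Set.Icc 0 1)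

theorem cubeMeasure_univ (d : ℕ) : cubeMeasure d Set.univ = 1 := by
  simp [Real.volume_Icc_pi]

instance (d : ℕ) : IsProbabilityMeasure (cubeMeasure d) := ⟨cubeMeasure_univ d⟩

/-- For `w ≠ 0` the character `x^w` is a continuous surjective homomorphism of compact groups, so it
carries Haar measure to Haar measure. This reduces integrals of binomials to one variable. -/
theorem measurePreserving_phase {d : ℕ} {w : Fin d → ℤ} (hw : w ≠ 0) :
    MeasurePreserving (fun θ : Fin d → ℝ => ((phase w θ : ℝ) : UnitAddCircle)) (cubeMeasure d)
      volume := by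
  have hcube : cubeMeasure d = Measure.pi fun _ => volume.restrict (Set.Ioc (0 : ℝ) (0 + 1)) := by
    rw [← Measure.restrict_pi_pi, zero_add]
    exact Measure.restrict_congr_set (Measure.univ_pi_Ioc_ae_eq_Icc (f := 0) (g := 1)).symm
  have hmk : MeasurePreserving (fun (θ : Fin d → ℝ) i => (θ i : UnitAddCircle)) (cubeMeasure d)
      volume := by
    rw [hcube]
    exact measurePreserving_pi _ _ fun _ => UnitAddCircle.measurePreserving_mk 0
  obtain ⟨i, hi⟩ := Function.ne_iff.mp hw
  let φ : (Fin d → UnitAddCircle) →+ UnitAddCircle := ∑ j, w j • Pi.evalAddMonoidHom _ j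
  have hφ : ∀ x, φ x = ∑ j, w j • x j := fun x => by simp [φ]
  have hsurj : Function.Surjective φ := by
    intro y
    obtain ⟨r, rfl⟩ := QuotientAddGroup.mk_surjective y
    -- Since `w i ≠ 0`, a preimage can be supported on coordinate `i` alone.
    refine ⟨Pi.single i ((r / w i : ℝ) : UnitAddCircle), ?_⟩
    rw [hφ, Finset.sum_eq_single i]
    · have : (w i : ℝ) ≠ 0 := by exact_mod_cast hi
      rw [Pi.single_eq_same, ← AddCircle.coe_zsmul, zsmul_eq_mul, mul_div_cancel₀ _ this]
    · intro j _ hj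
      simp [hj]
    · simp
  have hcont : Continuous φ := by
    have : (φ : (Fin d → UnitAddCircle) → UnitAddCircle) = fun x => ∑ j, w j • x j := funext hφ
    rw [this]
    fun_prop
  have huniv : (volume : Measure (Fin d → UnitAddCircle)) Set.univ =
      (volume : Measure UnitAddCircle) Set.univ := by
    rw [← hmk.map_eq, Measure.map_apply hmk.measurable .univ, Set.preimage_univ, cubeMeasure_univ,
      UnitAddCircle.measure_univ]
  convert (φ.measurePreserving hcont hsurj huniv).comp hmk using 1
  ext θ
  simp [hφ, phase]

theorem log_norm_toCircle_sub_one (x : ℝ) :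
    Real.log ‖(AddCircle.toCircle (x : UnitAddCircle) : ℂ) - 1‖ =
      Real.log ‖circleMap 0 1 (2 * Real.pi * x) - 1‖ := by
  rw [AddCircle.toCircle_apply_mk, Circle.coe_exp, circleMap]
  simp

theorem integrable_log_norm_toCircle_sub_one :
    Integrable fun x : UnitAddCircle => Real.log ‖(x.toCircle : ℂ) - 1‖ := by
  have hmeas : Measurable fun x : UnitAddCircle => Real.log ‖(x.toCircle : ℂ) - 1‖ :=
    Real.measurable_log.comp (by fun_prop)
  have hmk := UnitAddCircle.measurePreserving_mk 0
  rw [← hmk.integrable_comp hmeas.aestronglyMeasurable, zero_add]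
  have hint : CircleIntegrable (Real.log ‖· - 1‖) 0 1 := circleIntegrable_log_norm_sub_const 1
  have h := IntervalIntegrable.comp_mul_left (c := 2 * Real.pi) hint
  rw [zero_div, div_self Real.two_pi_pos.ne', intervalIntegrable_iff_integrableOn_Ioc_of_le
    zero_le_one] at h
  exact h.congr (.of_forall fun x => (log_norm_toCircle_sub_one x).symm)

/-- Jensen's formula: the circle average of `log |z - a|` vanishes for `|a| = 1`. -/
theorem integral_log_norm_toCircle_sub_one :
    ∫ x : UnitAddCircle, Real.log ‖(x.toCircle : ℂ) - 1‖ = 0 := by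
  rw [← UnitAddCircle.integral_preimage 0, zero_add, ← intervalIntegral.integral_of_le zero_le_one]
  simp only [log_norm_toCircle_sub_one]
  rw [intervalIntegral.integral_comp_mul_left
    (fun x => Real.log ‖circleMap 0 1 x - 1‖) Real.two_pi_pos.ne', mul_zero, mul_one]
  exact circleAverage_log_norm_sub_const₁ norm_one

theorem ae_toCircle_ne_one : ∀ᵐ x : UnitAddCircle, (x.toCircle : ℂ) ≠ 1 := by
  have hmk := UnitAddCircle.measurePreserving_mk 0
  have hmeas : MeasurableSet {x : UnitAddCircle | (x.toCircle : ℂ) ≠ 1} :=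
    (isClosed_eq (by fun_prop) continuous_const).measurableSet.compl
  rw [← hmk.map_eq, ae_map_iff hmk.measurable.aemeasurable hmeas]
  refine ae_restrict_of_ae ?_
  filter_upwards [(Set.countable_range ((↑) : ℤ → ℝ)).ae_notMem volume] with x hx h1
  refine hx ?_
  have h0 : (x : UnitAddCircle) = 0 := by
    apply AddCircle.injective_toCircle one_ne_zero
    rw [AddCircle.toCircle_zero]
    exact Circle.ext h1
  obtain ⟨m, hm⟩ := (AddCircle.coe_eq_zero_iff 1).mp h0
  exact ⟨m, by simpa using hm⟩

/-- `f` vanishes almost nowhere on the torus and `log |f|` is integrable with integral zero. -/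
structure HasZeroMahler {d : ℕ} (f : LaurentRing d) : Prop where
  ae_ne_zero : ∀ᵐ θ ∂cubeMeasure d, evalTorus θ f ≠ 0
  integrable : Integrable (logAbsOnTorus f) (cubeMeasure d)
  integral_eq_zero : ∫ θ, logAbsOnTorus f θ ∂cubeMeasure d = 0

theorem HasZeroMahler.monomial {d : ℕ} (s : Fin d → ℤ) : HasZeroMahler (monomial s) := by
  have h : logAbsOnTorus (PeriodicGraph.monomial s) = fun _ => 0 := by
    ext θ
    rw [logAbsOnTorus_eq, norm_evalTorus_monomial, Real.log_one]
  refine ⟨.of_forall fun θ => ?_, ?_, ?_⟩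
  · rw [← norm_ne_zero_iff, norm_evalTorus_monomial]
    exact one_ne_zero
  · rw [h]
    exact integrable_zero _ _ _
  · simp [h]

theorem norm_evalTorus_monomial_sub_monomial {d : ℕ} (s t : Fin d → ℤ) (θ : Fin d → ℝ) :
    ‖evalTorus θ (monomial s - monomial t)‖ =
      ‖(AddCircle.toCircle ((phase (s - t) θ : ℝ) : UnitAddCircle) : ℂ) - 1‖ := by
  have h : PeriodicGraph.monomial s - PeriodicGraph.monomial t =
      PeriodicGraph.monomial t * (PeriodicGraph.monomial (s - t) - 1) := by
    rw [mul_sub, AddMonoidAlgebra.single_mul_single]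
    simp
  rw [h, map_mul, norm_mul, norm_evalTorus_monomial, one_mul, map_sub, map_one, evalTorus_single,
    AddCircle.toCircle_apply_mk, Circle.coe_exp]
  congr 3
  push_cast
  ring_nf

theorem HasZeroMahler.monomial_sub_monomial {d : ℕ} {s t : Fin d → ℤ} (h : s ≠ t) :
    HasZeroMahler (PeriodicGraph.monomial s - PeriodicGraph.monomial t) := by
  have hφ := measurePreserving_phase (sub_ne_zero.mpr h)
  have hlog : logAbsOnTorus (PeriodicGraph.monomial s - PeriodicGraph.monomial t) =
      (fun x : UnitAddCircle => Real.log ‖(x.toCircle : ℂ) - 1‖) ∘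
        fun θ : Fin d → ℝ => ((phase (s - t) θ : ℝ) : UnitAddCircle) := by
    ext θ
    rw [logAbsOnTorus_eq, norm_evalTorus_monomial_sub_monomial]
    rfl
  refine ⟨?_, ?_, ?_⟩
  · filter_upwards [hφ.quasiMeasurePreserving.ae ae_toCircle_ne_one] with θ hθ
    rw [← norm_ne_zero_iff, norm_evalTorus_monomial_sub_monomial, norm_ne_zero_iff, sub_ne_zero]
    exact hθ
  · rw [hlog]
    exact hφ.integrable_comp_of_integrable integrable_log_norm_toCircle_sub_one
  · rw [hlog]
    have := integral_map (μ := cubeMeasure d) hφ.measurable.aemeasurable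
      (f := fun x : UnitAddCircle => Real.log ‖(x.toCircle : ℂ) - 1‖)
      (by rw [hφ.map_eq]; exact integrable_log_norm_toCircle_sub_one.aestronglyMeasurable)
    rw [hφ.map_eq, integral_log_norm_toCircle_sub_one] at this
    exact this.symm

theorem HasZeroMahler.neg {d : ℕ} {f : LaurentRing d} (hf : HasZeroMahler f) :
    HasZeroMahler (-f) := by
  have h : logAbsOnTorus (-f) = logAbsOnTorus f := by
    ext θ
    rw [logAbsOnTorus_eq, logAbsOnTorus_eq, map_neg, norm_neg]
  refine ⟨?_, h ▸ hf.integrable, h ▸ hf.integral_eq_zero⟩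
  filter_upwards [hf.ae_ne_zero] with θ hθ
  rwa [map_neg, neg_ne_zero]

theorem HasZeroMahler.mul {d : ℕ} {f g : LaurentRing d} (hf : HasZeroMahler f)
    (hg : HasZeroMahler g) : HasZeroMahler (f * g) := by
  have h : logAbsOnTorus (f * g) =ᵐ[cubeMeasure d] logAbsOnTorus f + logAbsOnTorus g := by
    filter_upwards [hf.ae_ne_zero, hg.ae_ne_zero] with θ hθ hθ'
    simp only [Pi.add_apply, logAbsOnTorus_eq]
    rw [map_mul, norm_mul, Real.log_mul (norm_ne_zero_iff.mpr hθ) (norm_ne_zero_iff.mpr hθ')]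
  refine ⟨?_, (hf.integrable.add hg.integrable).congr h.symm, ?_⟩
  · filter_upwards [hf.ae_ne_zero, hg.ae_ne_zero] with θ hθ hθ'
    rw [map_mul]
    exact mul_ne_zero hθ hθ'
  · rw [integral_congr_ae h]
    simp only [Pi.add_apply]
    rw [integral_add hf.integrable hg.integrable, hf.integral_eq_zero, hg.integral_eq_zero, add_zero]

theorem IsMonomialBinomialProduct.hasZeroMahler {d : ℕ} {f : LaurentRing d}
    (hf : IsMonomialBinomialProduct f) : HasZeroMahler f := by
  induction hf with
  | single s => exact .monomial s
  | single_sub_single s t h => exact .monomial_sub_monomial h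
  | neg _ ih => exact ih.neg
  | mul _ _ ihf ihg => exact ihf.mul ihg

/-- If `|f|` dominates a positive multiple of `|b c|` on the torus, where `b` and `c` have Mahler measure zero, `log |f|` is
integrable. -/
theorem integrable_logAbsOnTorus_of_mul_le {d : ℕ} {f b c : LaurentRing d} (hb : HasZeroMahler b)
    (hc : HasZeroMahler c) {r : ℝ} (hr : 0 < r)
    (h : ∀ θ, r * (‖evalTorus θ b‖ * ‖evalTorus θ c‖) ≤ ‖evalTorus θ f‖) :
    Integrable (logAbsOnTorus f) (cubeMeasure d) ∧
      Real.log r ≤ ∫ θ, logAbsOnTorus f θ ∂cubeMeasure d := by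
  -- The zeros of `b` and `c` must be discarded: there `Real.log 0 = 0` breaks both additivity and
  -- monotonicity.
  have hlower : ∀ᵐ θ ∂cubeMeasure d,
      Real.log r + (logAbsOnTorus b θ + logAbsOnTorus c θ) ≤ logAbsOnTorus f θ := by
    filter_upwards [hb.ae_ne_zero, hc.ae_ne_zero] with θ hbθ hcθ
    have hbθ := norm_ne_zero_iff.mpr hbθ
    have hcθ := norm_ne_zero_iff.mpr hcθ
    rw [logAbsOnTorus_eq, logAbsOnTorus_eq, logAbsOnTorus_eq, ← Real.log_mul hbθ hcθ,
      ← Real.log_mul hr.ne' (mul_ne_zero hbθ hcθ)]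
    exact Real.log_le_log (by positivity) (h θ)
  have hbc : Integrable (fun θ => Real.log r + (logAbsOnTorus b θ + logAbsOnTorus c θ))
      (cubeMeasure d) := (integrable_const _).add (hb.integrable.add hc.integrable)
  obtain ⟨K, hK⟩ := isCompact_Icc.exists_bound_of_continuousOn
    (s := Set.Icc (0 : Fin d → ℝ) 1) (continuous_evalTorus f).continuousOn
  have hupper : ∀ᵐ θ ∂cubeMeasure d, logAbsOnTorus f θ ≤ K := by
    filter_upwards [ae_restrict_mem measurableSet_Icc] with θ hθ
    rw [logAbsOnTorus_eq]
    exact (Real.log_le_self (norm_nonneg _)).trans (hK θ hθ)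
  -- The function lies between an integrable function and a constant.
  have hint : Integrable (logAbsOnTorus f) (cubeMeasure d) := by
    refine (hbc.abs.add (integrable_const |K|)).mono'
      (measurable_logAbsOnTorus f).aestronglyMeasurable ?_
    filter_upwards [hlower, hupper] with θ h1 h2
    rw [Real.norm_eq_abs, Pi.add_apply, abs_le]
    constructor
    · have := neg_abs_le (Real.log r + (logAbsOnTorus b θ + logAbsOnTorus c θ))
      have := abs_nonneg K
      linarith
    · have := abs_nonneg (Real.log r + (logAbsOnTorus b θ + logAbsOnTorus c θ))
      have := le_abs_self K
      linarith
  refine ⟨hint, ?_⟩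
  have := integral_mono_ae hbc hint hlower
  rwa [integral_add (f := fun _ => Real.log r)
      (g := fun θ => logAbsOnTorus b θ + logAbsOnTorus c θ)
      (integrable_const _) (hb.integrable.add hc.integrable),
    integral_add hb.integrable hc.integrable, hb.integral_eq_zero, hc.integral_eq_zero,
    integral_const, probReal_univ, one_smul, add_zero, add_zero] at this

/-! ### Orbit representatives and the factorization of the Laplacian matrix -/

variable {α β : Type*}

theorem IsOrbitRepresentatives.vadd_inj {d n : ℕ} [AddAction (Fin d → ℤ) α]
    [AddAction (Fin d → ℤ) β] {G : Graph α β} {v : Fin n → α}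
    (hv : IsOrbitRepresentatives d G v) (hG : HasCofiniteFreeSymmetry d G) {a b : Fin d → ℤ}
    {k l : Fin n} (h : a +ᵥ v k = b +ᵥ v l) : k = l ∧ a = b := by
  have hmem : b +ᵥ v l ∈ G.vertexSet := (hG.mem_vertexSet_iff _ _).mpr (hv.mem l)
  have hkl : k = l := (hv.existsUnique _ hmem).unique ⟨a, h⟩ ⟨b, rfl⟩
  subst hkl
  refine ⟨rfl, ?_⟩
  have : (-b + a) +ᵥ v k = v k := by rw [add_vadd, h, neg_vadd_vadd]
  have := hG.free_vertices _ _ (hv.mem k) this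
  rw [neg_add_eq_zero] at this
  exact this.symm

/-- `r` lists exactly one edge of every orbit of non-loop edges of `G`, and the edge `r e` joins
`s e +ᵥ v (i e)` to `t e +ᵥ v (j e)`. -/
structure IsEdgeRepresentatives {d n : ℕ} [AddAction (Fin d → ℤ) α] [AddAction (Fin d → ℤ) β]
    (G : Graph α β) (v : Fin n → α) {E : Type*} (r : E → β) (i j : E → Fin n)
    (s t : E → Fin d → ℤ) : Prop where
  isLink : ∀ e, G.IsLink (r e) (s e +ᵥ v (i e)) (t e +ᵥ v (j e))
  ne : ∀ e, s e +ᵥ v (i e) ≠ t e +ᵥ v (j e)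
  exists_vadd_eq : ∀ b x y, G.IsLink b x y → x ≠ y → ∃ e, ∃ g : Fin d → ℤ, b = g +ᵥ r e
  eq_of_vadd_eq : ∀ e e' (g : Fin d → ℤ), r e = g +ᵥ r e' → e = e'

/-- Every graph with cofinite free symmetry has a finite list of representatives of the orbits of
non-loop edges. -/
theorem exists_isEdgeRepresentatives {d n : ℕ} [AddAction (Fin d → ℤ) α]
    [AddAction (Fin d → ℤ) β] {G : Graph α β} {v : Fin n → α}
    (hG : HasCofiniteFreeSymmetry d G) (hv : IsOrbitRepresentatives d G v) :
    ∃ (m : ℕ) (r : Fin m → β) (i j : Fin m → Fin n) (s t : Fin m → Fin d → ℤ),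
      IsEdgeRepresentatives G v r i j s t := by
  set S : Set (Set β) := AddAction.orbit (Fin d → ℤ) '' {b | ∃ x y, G.IsLink b x y ∧ x ≠ y} with hS
  have hfin : S.Finite := hG.finite_edge_orbits.subset
    (Set.image_mono fun b ⟨x, y, h, _⟩ => h.edge_mem)
  have : Finite S := hfin
  obtain ⟨m, ⟨φ⟩⟩ := Finite.exists_equiv_fin S
  have hrep : ∀ e : Fin m, ∃ b x y, G.IsLink b x y ∧ x ≠ y ∧
      AddAction.orbit (Fin d → ℤ) b = φ.symm e := by
    intro e
    obtain ⟨b, ⟨x, y, h, hne⟩, hb⟩ := (φ.symm e).2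
    exact ⟨b, x, y, h, hne, hb⟩
  choose r x y hlink hne horbit using hrep
  have hvertex : ∀ z ∈ G.vertexSet, ∃ (i : Fin n) (s : Fin d → ℤ), s +ᵥ v i = z := by
    intro z hz
    obtain ⟨i, ⟨s, hs⟩, _⟩ := hv.existsUnique z hz
    exact ⟨i, s, hs⟩
  choose i s his using fun e => hvertex (x e) (hlink e).left_mem
  choose j t hjt using fun e => hvertex (y e) (hlink e).right_mem
  refine ⟨m, r, i, j, s, t, ⟨fun e => ?_, fun e => ?_, ?_, ?_⟩⟩
  · rw [his, hjt]
    exact hlink e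
  · rw [his, hjt]
    exact hne e
  · intro b x' y' hb hxy
    refine ⟨φ ⟨_, b, ⟨x', y', hb, hxy⟩, rfl⟩, ?_⟩
    have h := horbit (φ ⟨_, b, ⟨x', y', hb, hxy⟩, rfl⟩)
    rw [Equiv.symm_apply_apply] at h
    have hmem : b ∈ AddAction.orbit (Fin d → ℤ) (r (φ ⟨_, b, ⟨x', y', hb, hxy⟩, rfl⟩)) := by
      rw [h]
      exact AddAction.mem_orbit_self b
    obtain ⟨g, hg⟩ := hmem
    exact ⟨g, hg.symm⟩
  · intro e e' g h
    apply φ.symm.injective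
    apply Subtype.ext
    rw [← horbit, ← horbit, AddAction.orbit_eq_iff]
    exact ⟨g, h.symm⟩

/-- The incidence matrix of the quotient graph, weighted by monomials. -/
def incidenceMatrix {d n : ℕ} {E : Type*} (i j : E → Fin n) (s t : E → Fin d → ℤ) :
    Matrix (Fin n) E (LaurentRing d) :=
  Matrix.of fun k e => (Pi.single (i e) (monomial (-s e)) - Pi.single (j e) (monomial (-t e)) :
    Fin n → LaurentRing d) k

namespace IsEdgeRepresentatives

/-- An end of a dart, i.e. of an edge representative with one of its two directions. -/
def dartEnd {E X : Type*} (a b : E → X) (p : E × Bool) : X := if p.2 then b p.1 else a p.1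

variable {d n : ℕ} [AddAction (Fin d → ℤ) α] [AddAction (Fin d → ℤ) β] {G : Graph α β}
  {v : Fin n → α} {E : Type*} {r : E → β} {i j : E → Fin n} {s t : E → Fin d → ℤ}

theorem isLink_dart (hr : IsEdgeRepresentatives G v r i j s t) (hG : HasCofiniteFreeSymmetry d G)
    (p : E × Bool) :
    G.IsLink (-dartEnd s t p +ᵥ r p.1) (v (dartEnd i j p))
      ((dartEnd t s p - dartEnd s t p) +ᵥ v (dartEnd j i p)) := by
  have h : G.IsLink (r p.1) (dartEnd s t p +ᵥ v (dartEnd i j p))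
      (dartEnd t s p +ᵥ v (dartEnd j i p)) := by
    obtain ⟨e, _ | _⟩ := p
    · exact hr.isLink e
    · exact (hr.isLink e).symm
  rw [← hG.isLink_iff (-dartEnd s t p), neg_vadd_vadd, ← add_vadd, neg_add_eq_sub] at h
  exact h

theorem dart_ne (hr : IsEdgeRepresentatives G v r i j s t) (p : E × Bool) :
    v (dartEnd i j p) ≠ (dartEnd t s p - dartEnd s t p) +ᵥ v (dartEnd j i p) := by
  have h : dartEnd s t p +ᵥ v (dartEnd i j p) ≠ dartEnd t s p +ᵥ v (dartEnd j i p) := by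
    obtain ⟨e, _ | _⟩ := p
    · exact hr.ne e
    · exact (hr.ne e).symm
  intro h'
  apply h
  rw [h', ← add_vadd, add_sub_cancel]

/-- Every non-loop edge at `v k` is a translate of a representative with a chosen direction.
Freeness on vertices fixes the translation, because the dart must start at `v k` itself. Thus
degrees and edge counts become counts of darts. -/
theorem exists_dart (hr : IsEdgeRepresentatives G v r i j s t) (hG : HasCofiniteFreeSymmetry d G)
    (hv : IsOrbitRepresentatives d G v) {b : β} {k : Fin n} {y : α} (h : G.IsLink b (v k) y)
    (hne : v k ≠ y) :
    ∃ p : E × Bool, dartEnd i j p = k ∧ -dartEnd s t p +ᵥ r p.1 = b ∧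
      (dartEnd t s p - dartEnd s t p) +ᵥ v (dartEnd j i p) = y := by
  obtain ⟨e, g, rfl⟩ := hr.exists_vadd_eq b _ _ h hne
  have hlink := (hG.isLink_iff g _ _ _).mpr (hr.isLink e)
  have key : ∀ p : E × Bool, p.1 = e → v k = g +ᵥ dartEnd s t p +ᵥ v (dartEnd i j p) →
      y = g +ᵥ dartEnd t s p +ᵥ v (dartEnd j i p) →
      ∃ p : E × Bool, dartEnd i j p = k ∧ -dartEnd s t p +ᵥ r p.1 = g +ᵥ r e ∧
        (dartEnd t s p - dartEnd s t p) +ᵥ v (dartEnd j i p) = y := by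
    rintro p rfl hk hy
    rw [← add_vadd, ← zero_vadd (Fin d → ℤ) (v k)] at hk
    obtain ⟨hk, h0⟩ := hv.vadd_inj hG hk
    have hg : g = -dartEnd s t p := eq_neg_of_add_eq_zero_left h0.symm
    refine ⟨p, hk.symm, by rw [hg], ?_⟩
    rw [hy, ← add_vadd, hg, neg_add_eq_sub]
  rcases h.eq_and_eq_or_eq_and_eq hlink with ⟨h1, h2⟩ | ⟨h1, h2⟩
  · exact key (e, false) rfl h1 h2
  · exact key (e, true) rfl h1 h2

/-- Equal translates come from the same representative, and freeness on edges makes the translations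
equal. Opposite directions starting at the same `v k` would then force the representative to be a
loop. -/
theorem dart_injOn (hr : IsEdgeRepresentatives G v r i j s t) (hG : HasCofiniteFreeSymmetry d G)
    (k : Fin n) :
    Set.InjOn (fun p : E × Bool => -dartEnd s t p +ᵥ r p.1) {p | dartEnd i j p = k} := by
  rintro ⟨e, a⟩ hp ⟨e', a'⟩ hp' h
  simp only at h
  have h' : r e = (dartEnd s t (e, a) - dartEnd s t (e', a')) +ᵥ r e' := by
    rw [sub_eq_add_neg, add_vadd, ← h, vadd_neg_vadd]
  obtain rfl := hr.eq_of_vadd_eq _ _ _ h'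
  have hs := sub_eq_zero.mp (hG.free_edges _ _ (hr.isLink e).edge_mem h'.symm)
  have hi : dartEnd i j (e, a) = dartEnd i j (e, a') := hp.trans hp'.symm
  have hne : ¬(i e = j e ∧ s e = t e) := fun ⟨h1, h2⟩ => hr.ne e (by rw [h1, h2])
  cases a <;> cases a'
  · rfl
  · exact absurd ⟨hi, hs⟩ hne
  · exact absurd ⟨hi.symm, hs.symm⟩ hne
  · rfl

theorem degree_eq [Fintype E] (hr : IsEdgeRepresentatives G v r i j s t)
    (hG : HasCofiniteFreeSymmetry d G) (hv : IsOrbitRepresentatives d G v) (k : Fin n) :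
    degree G (v k) = (Finset.univ.filter fun p : E × Bool => dartEnd i j p = k).card := by
  have : {b | G.IsNonloopAt b (v k)} = (fun p : E × Bool => -dartEnd s t p +ᵥ r p.1) ''
      (Finset.univ.filter fun p : E × Bool => dartEnd i j p = k : Finset (E × Bool)) := by
    ext b
    constructor
    · rintro ⟨y, hy, hb⟩
      obtain ⟨p, hp, hpb, -⟩ := hr.exists_dart hG hv hb hy.symm
      exact ⟨p, by simpa using hp, hpb⟩
    · rintro ⟨p, hp, rfl⟩
      obtain rfl : dartEnd i j p = k := by simpa using hp
      exact ⟨_, (hr.dart_ne p).symm, hr.isLink_dart hG p⟩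
  rw [degree, this, Set.InjOn.ncard_image, Set.ncard_coe_finset]
  exact (hr.dart_injOn hG k).mono fun p hp => by simpa using hp

theorem edgeCount_eq [Fintype E] (hr : IsEdgeRepresentatives G v r i j s t)
    (hG : HasCofiniteFreeSymmetry d G) (hv : IsOrbitRepresentatives d G v) (k l : Fin n)
    (g : Fin d → ℤ) :
    edgeCount G (v k) (g +ᵥ v l) =
      ((Finset.univ.filter fun p : E × Bool => dartEnd i j p = k ∧ dartEnd j i p = l).filter
        fun p => dartEnd t s p - dartEnd s t p = g).card := by
  have : {b | G.IsLink b (v k) (g +ᵥ v l) ∧ v k ≠ g +ᵥ v l} =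
      (fun p : E × Bool => -dartEnd s t p +ᵥ r p.1) ''
      ((Finset.univ.filter fun p : E × Bool => dartEnd i j p = k ∧ dartEnd j i p = l).filter
        fun p => dartEnd t s p - dartEnd s t p = g : Finset (E × Bool)) := by
    ext b
    constructor
    · rintro ⟨hb, hne⟩
      obtain ⟨p, hp, hpb, hy⟩ := hr.exists_dart hG hv hb hne
      obtain ⟨hl, hg⟩ := hv.vadd_inj hG hy
      exact ⟨p, by simp [hp, hl, hg], hpb⟩
    · rintro ⟨p, hp, rfl⟩
      simp only [Finset.coe_filter, Finset.mem_filter, Finset.mem_univ, true_and,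
        Set.mem_ofPred_eq] at hp
      obtain ⟨⟨rfl, rfl⟩, rfl⟩ := hp
      exact ⟨hr.isLink_dart hG p, hr.dart_ne p⟩
  rw [edgeCount, this, Set.InjOn.ncard_image, Set.ncard_coe_finset]
  exact (hr.dart_injOn hG k).mono fun p hp => by
    simp only [Finset.coe_filter, Finset.mem_filter, Finset.mem_univ, true_and,
      Set.mem_ofPred_eq] at hp
    exact hp.1.1

theorem finsum_edgeCount [Fintype E] (hr : IsEdgeRepresentatives G v r i j s t)
    (hG : HasCofiniteFreeSymmetry d G) (hv : IsOrbitRepresentatives d G v) (k l : Fin n) :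
    (∑ᶠ g : Fin d → ℤ, AddMonoidAlgebra.single g (edgeCount G (v k) (g +ᵥ v l) : ℤ) :
      LaurentRing d) =
      ∑ p : E × Bool with dartEnd i j p = k ∧ dartEnd j i p = l,
        monomial (dartEnd t s p - dartEnd s t p) := by
  classical
  rw [Finset.sum_comp (fun g => (monomial g : LaurentRing d))
    (fun p : E × Bool => dartEnd t s p - dartEnd s t p)]
  simp only [hr.edgeCount_eq hG hv]
  -- The `finsum` takes its default value `0` on infinite support; here the support lies in the
  -- finite set of dart displacements.
  rw [finsum_eq_sum_of_support_subset]
  · refine Finset.sum_congr rfl fun g _ => ?_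
    rw [AddMonoidAlgebra.smul_single, nsmul_eq_mul, mul_one]
  · intro g hg
    rw [Function.mem_support] at hg
    by_contra hmem
    apply hg
    rw [Finset.card_eq_zero.mpr, Nat.cast_zero, AddMonoidAlgebra.single_zero]
    refine Finset.filter_eq_empty_iff.mpr fun p hp h => hmem ?_
    exact Finset.mem_coe.mpr (Finset.mem_image.mpr ⟨p, hp, h⟩)

/-- The Laplacian matrix is the incidence matrix times its adjoint. -/
theorem laplacianMatrix_eq [Fintype E] (hr : IsEdgeRepresentatives G v r i j s t)
    (hG : HasCofiniteFreeSymmetry d G) (hv : IsOrbitRepresentatives d G v) :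
    laplacianMatrix d G v =
      incidenceMatrix i j s t * ((incidenceMatrix i j s t).map (inversion d)).transpose := by
  ext1 k l
  rw [laplacianMatrix, Matrix.sub_apply, Matrix.of_apply, hr.finsum_edgeCount hG hv,
    Matrix.diagonal_apply, hr.degree_eq hG hv, Matrix.mul_apply, Finset.card_filter,
    Finset.sum_filter, Fintype.sum_prod_type, Fintype.sum_prod_type]
  push_cast
  rw [show (if k = l then ∑ e : E, ∑ a : Bool, (if dartEnd i j (e, a) = k then (1 : LaurentRing d)
      else 0) else 0) = ∑ e : E, if k = l then ∑ a : Bool, (if dartEnd i j (e, a) = k then 1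
      else 0) else 0 by split_ifs <;> simp, ← Finset.sum_sub_distrib]
  -- Edge by edge: with ends `a`, `b` and shifts `s`, `t`, both sides get `1` at `(a,a)` and
  -- `(b,b)`, `-x^(t-s)` at `(a,b)` and `-x^(s-t)` at `(b,a)`; all four add up in one entry if `a =
  -- b`.
  refine Finset.sum_congr rfl fun e _ => ?_
  simp only [Fintype.sum_bool, dartEnd, incidenceMatrix, Matrix.of_apply, Matrix.transpose_apply,
    Matrix.map_apply, Pi.sub_apply, Pi.single_apply, map_sub, apply_ite (inversion d),
    inversion_single, map_zero, neg_neg]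
  have h0 : (AddMonoidAlgebra.single 0 1 : LaurentRing d) = 1 := rfl
  generalize i e = a
  generalize j e = b
  simp only [eq_comm (a := k) (b := a), eq_comm (a := k) (b := b), eq_comm (a := l) (b := a),
    eq_comm (a := l) (b := b)]
  rcases eq_or_ne k l with rfl | hkl
  · by_cases h1 : a = k <;> by_cases h2 : b = k <;>
      simp [h1, h2, sub_mul, mul_sub, AddMonoidAlgebra.single_mul_single,
        h0, neg_add_eq_sub]
    abel
  · by_cases h1 : a = k <;> by_cases h2 : b = k <;> by_cases h3 : a = l <;> by_cases h4 : b = l <;>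
      simp [h1, h2, h3, h4, hkl, hkl.symm, mul_sub, AddMonoidAlgebra.single_mul_single, neg_add_eq_sub]

end IsEdgeRepresentatives

/-! ### Cauchy–Binet on the torus and the gap -/

theorem HasZeroMahler.logMahler_eq_log {d : ℕ} {f b : LaurentRing d} (hb : HasZeroMahler b) {r : ℝ}
    (hr : 0 < r) (h : ∀ θ, ‖evalTorus θ f‖ = r * ‖evalTorus θ b‖) :
    Integrable (logAbsOnTorus f) (cubeMeasure d) ∧ logMahler f = Real.log r := by
  have hlog : logAbsOnTorus f =ᵐ[cubeMeasure d] fun θ => Real.log r + logAbsOnTorus b θ := by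
    filter_upwards [hb.ae_ne_zero] with θ hθ
    rw [logAbsOnTorus_eq, logAbsOnTorus_eq, h, Real.log_mul hr.ne' (norm_ne_zero_iff.mpr hθ)]
  refine ⟨((integrable_const _).add hb.integrable).congr hlog.symm, ?_⟩
  rw [logMahler, integral_congr_ae hlog, integral_add (integrable_const _) hb.integrable,
    hb.integral_eq_zero, integral_const, probReal_univ, one_smul, add_zero]

section CauchyBinet

variable {d n : ℕ} {E : Type*} {i j : E → Fin n} {s t : E → Fin d → ℤ}

theorem det_incidenceMatrix_submatrix_eq_zero_or (f : Fin n → E) :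
    ((incidenceMatrix i j s t).submatrix id f).det = 0 ∨
      HasZeroMahler ((incidenceMatrix i j s t).submatrix id f).det :=
  (det_eq_zero_or_isMonomialBinomialProduct _ fun l =>
    ⟨Pi.single (i (f l)) (monomial (-s (f l))), Pi.single (j (f l)) (monomial (-t (f l))),
      .inr ⟨_, _, rfl⟩, .inr ⟨_, _, rfl⟩, rfl⟩).imp_right
    IsMonomialBinomialProduct.hasZeroMahler

theorem factorial_mul_norm_evalTorus_det [Fintype E] (B : Matrix (Fin n) E (LaurentRing d))
    (θ : Fin d → ℝ) :
    (n.factorial : ℝ) * ‖evalTorus θ (B * (B.map (inversion d)).transpose).det‖ =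
      ∑ f : Fin n → E, ‖evalTorus θ (B.submatrix id f).det‖ ^ 2 := by
  have h := congrArg (evalTorus θ) (factorial_mul_det_mul B (B.map (inversion d)).transpose)
  have hterm : ∀ f : Fin n → E,
      evalTorus θ ((B.submatrix id f).det *
        ((B.map (inversion d)).transpose.submatrix f id).det) =
        ((‖evalTorus θ (B.submatrix id f).det‖ ^ 2 : ℝ) : ℂ) := by
    intro f
    have hf : (B.map (inversion d)).transpose.submatrix f id =
        ((inversion d).mapMatrix (B.submatrix id f)).transpose := rfl
    rw [hf, Matrix.det_transpose, ← RingHom.map_det, evalTorus_mul_inversion]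
  rw [Fintype.card_fin, map_mul, map_natCast, map_sum, Finset.sum_congr rfl fun f _ => hterm f,
    ← Complex.ofReal_sum] at h
  have := congrArg norm h
  rwa [norm_mul, Complex.norm_natCast, Complex.norm_real, Real.norm_of_nonneg
    (Finset.sum_nonneg fun f _ => by positivity)] at this

theorem norm_evalTorus_det_comp_perm (B : Matrix (Fin n) E (LaurentRing d)) (θ : Fin d → ℝ)
    (f : Fin n → E) (σ : Equiv.Perm (Fin n)) :
    ‖evalTorus θ (B.submatrix id (f ∘ σ)).det‖ = ‖evalTorus θ (B.submatrix id f).det‖ := by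
  have h : B.submatrix id (f ∘ σ) = (B.submatrix id f).submatrix id σ := rfl
  rw [h, Matrix.det_permute', map_mul, norm_mul]
  rcases Int.units_eq_one_or (Equiv.Perm.sign σ) with hσ | hσ <;> simp [hσ]

/-- A nonzero minor has distinct columns, so its `n!` reorderings are distinct, and they agree in
absolute value. This cancels the factorial of Cauchy–Binet. -/
theorem sum_norm_sq_comp_perm [DecidableEq (Fin n → E)] (B : Matrix (Fin n) E (LaurentRing d))
    (θ : Fin d → ℝ) {f : Fin n → E} (hf : (B.submatrix id f).det ≠ 0) :
    ∑ g ∈ Finset.univ.image (fun σ : Equiv.Perm (Fin n) => f ∘ σ),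
      ‖evalTorus θ (B.submatrix id g).det‖ ^ 2 =
      n.factorial * ‖evalTorus θ (B.submatrix id f).det‖ ^ 2 := by
  have hinj : Function.Injective f := by
    intro a b hab
    by_contra hne
    exact hf (Matrix.det_zero_of_column_eq hne fun k => by simp [hab])
  have hcomp : Function.Injective fun σ : Equiv.Perm (Fin n) => f ∘ σ :=
    fun σ τ h => Equiv.ext fun k => hinj (congrFun h k)
  rw [Finset.sum_image hcomp.injOn]
  simp only [norm_evalTorus_det_comp_perm]
  rw [Finset.sum_const, Finset.card_univ, Fintype.card_perm, Fintype.card_fin, nsmul_eq_mul]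

/-- The determinant of `B * B^*`, for an incidence matrix `B`, has logarithmic Mahler measure zero
or at least `log 2`. -/
theorem logMahler_det_incidenceMatrix_mul [Fintype E]
    (hne : (incidenceMatrix i j s t *
      ((incidenceMatrix i j s t).map (inversion d)).transpose).det ≠ 0) :
    Integrable (logAbsOnTorus (incidenceMatrix i j s t *
        ((incidenceMatrix i j s t).map (inversion d)).transpose).det) (cubeMeasure d) ∧
      (logMahler (incidenceMatrix i j s t *
          ((incidenceMatrix i j s t).map (inversion d)).transpose).det = 0 ∨
        Real.log 2 ≤ logMahler (incidenceMatrix i j s t *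
          ((incidenceMatrix i j s t).map (inversion d)).transpose).det) := by
  classical
  have hmahler := det_incidenceMatrix_submatrix_eq_zero_or (i := i) (j := j) (s := s) (t := t)
  set B := incidenceMatrix i j s t
  have hfact : (0 : ℝ) < n.factorial := by exact_mod_cast n.factorial_pos
  have hsum := factorial_mul_norm_evalTorus_det B
  -- Otherwise `n! * Δ = 0`, while `n!` is nonzero in the Laurent ring, as evaluation at a point
  -- shows.
  obtain ⟨f, hf⟩ : ∃ f : Fin n → E, (B.submatrix id f).det ≠ 0 := by
    by_contra! hall
    have h := factorial_mul_det_mul B (B.map (inversion d)).transpose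
    simp only [hall, zero_mul, Finset.sum_const_zero] at h
    refine hne ((mul_eq_zero.mp h).resolve_left fun h0 => ?_)
    have := congrArg (evalTorus 0) h0
    rw [map_natCast, map_zero, Nat.cast_eq_zero] at this
    exact Nat.factorial_ne_zero _ this
  have hzf := (hmahler f).resolve_left hf
  set orbit : (Fin n → E) → Finset (Fin n → E) :=
    fun f => Finset.univ.image fun σ : Equiv.Perm (Fin n) => f ∘ σ with horbit
  by_cases hother : ∃ g, (B.submatrix id g).det ≠ 0 ∧ g ∉ orbit f
  · obtain ⟨g, hg, hgf⟩ := hother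
    have hdisj : Disjoint (orbit f) (orbit g) := by
      rw [Finset.disjoint_left]
      intro a ha hb
      obtain ⟨σ, -, rfl⟩ := Finset.mem_image.mp ha
      obtain ⟨τ, -, hτ⟩ := Finset.mem_image.mp hb
      -- From `g ∘ τ = f ∘ σ` one gets `g = f ∘ (σ ∘ τ⁻¹)`.
      refine hgf (Finset.mem_image.mpr ⟨τ⁻¹.trans σ, Finset.mem_univ _, ?_⟩)
      ext1 k
      have := congrFun hτ (τ⁻¹ k)
      simpa using this.symm
    have key := integrable_logAbsOnTorus_of_mul_le (f := (B * (B.map (inversion d)).transpose).det)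
      hzf ((hmahler g).resolve_left hg) two_pos fun θ => by
        have hle : ∑ a ∈ orbit f ∪ orbit g, ‖evalTorus θ (B.submatrix id a).det‖ ^ 2 ≤
            ∑ a, ‖evalTorus θ (B.submatrix id a).det‖ ^ 2 :=
          Finset.sum_le_sum_of_subset_of_nonneg (Finset.subset_univ _) fun _ _ _ => by positivity
        rw [Finset.sum_union hdisj, sum_norm_sq_comp_perm B θ hf, sum_norm_sq_comp_perm B θ hg,
          ← hsum θ, ← mul_add] at hle
        have h1 := le_of_mul_le_mul_left hle hfact
        have h2 := two_mul_le_add_sq ‖evalTorus θ (B.submatrix id f).det‖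
          ‖evalTorus θ (B.submatrix id g).det‖
        linarith
    exact ⟨key.1, .inr key.2⟩
  -- All nonzero minors use the same columns as `f`, so `|Δ|` is the square of one of them.
  · push Not at hother
    have key := (hzf.mul hzf).logMahler_eq_log (f := (B * (B.map (inversion d)).transpose).det)
      one_pos fun θ => by
        have heq : ∑ a, ‖evalTorus θ (B.submatrix id a).det‖ ^ 2 =
            ∑ a ∈ orbit f, ‖evalTorus θ (B.submatrix id a).det‖ ^ 2 := by
          refine (Finset.sum_subset (Finset.subset_univ _) fun a _ ha => ?_).symm
          rw [not_imp_comm.mp (hother a) ha]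
          simp
        rw [sum_norm_sq_comp_perm B θ hf, ← hsum θ] at heq
        rw [mul_left_cancel₀ hfact.ne' heq, map_mul, norm_mul]
        ring
    exact ⟨key.1, .inl (key.2.trans Real.log_one)⟩

end CauchyBinet

/-! ### The doubled line -/

theorem doubledLine_hasCofiniteFreeSymmetry : HasCofiniteFreeSymmetry 1 doubledLine where
  mem_vertexSet_iff _ _ := Iff.rfl
  isLink_iff s e x y := by
    change ((s + x = s + e.base ∧ s + y = s + e.base + 1) ∨
      (s + x = s + e.base + 1 ∧ s + y = s + e.base)) ↔ _
    simp only [add_assoc, add_right_inj]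
    rfl
  free_vertices s x _ h := add_eq_right.mp h
  free_edges s e _ h := add_eq_right.mp (congrArg DoubledLineEdge.base h)
  finite_vertex_orbits := by
    refine (Set.finite_singleton (AddAction.orbit (Fin 1 → ℤ) (0 : Fin 1 → ℤ))).subset ?_
    rintro _ ⟨x, _, rfl⟩
    exact AddAction.orbit_eq_iff.mpr ⟨x, add_zero x⟩
  finite_edge_orbits := by
    refine (Set.finite_range fun c : Bool =>
      AddAction.orbit (Fin 1 → ℤ) (⟨0, c⟩ : DoubledLineEdge)).subset ?_
    rintro _ ⟨e, _, rfl⟩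
    refine ⟨e.copy, Eq.symm (AddAction.orbit_eq_iff.mpr ⟨e.base, ?_⟩)⟩
    exact DoubledLineEdge.ext (add_zero e.base) rfl

theorem doubledLine_isOrbitRepresentatives :
    IsOrbitRepresentatives 1 doubledLine fun _ : Fin 1 => (0 : Fin 1 → ℤ) where
  mem _ := Set.mem_univ _
  existsUnique x _ := ⟨0, ⟨x, add_zero x⟩, fun _ _ => Subsingleton.elim _ _⟩

theorem doubledLine_isEdgeRepresentatives :
    IsEdgeRepresentatives (d := 1) doubledLine (fun _ : Fin 1 => (0 : Fin 1 → ℤ))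
      (fun c : Bool => (⟨0, c⟩ : DoubledLineEdge)) (fun _ => 0) (fun _ => 0) (fun _ => 0)
      (fun _ => 1) where
  isLink _ := .inl ⟨rfl, add_comm _ _⟩
  ne _ h := zero_ne_one (add_right_cancel h : (0 : Fin 1 → ℤ) = 1)
  exists_vadd_eq b _ _ _ _ := ⟨b.copy, b.base, DoubledLineEdge.ext (add_zero b.base).symm rfl⟩
  eq_of_vadd_eq _ _ _ h := congrArg DoubledLineEdge.copy h

/-- The two parallel edges have the same incidence column `b = 1 - x⁻¹`, so `Δ = 2 b b^*` and `|Δ| =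
2|b|²`; only the factor `2` contributes. -/
theorem logMahler_doubledLine :
    logMahler (laplacianPolynomial 1 doubledLine fun _ : Fin 1 => (0 : Fin 1 → ℤ)) =
      Real.log 2 := by
  have hb := HasZeroMahler.monomial_sub_monomial
    (show (-0 : Fin 1 → ℤ) ≠ -1 from fun h => zero_ne_one (neg_injective h))
  refine ((hb.mul hb).logMahler_eq_log two_pos fun θ => ?_).2
  have hdet : laplacianPolynomial 1 doubledLine (fun _ : Fin 1 => (0 : Fin 1 → ℤ)) =
      2 * ((monomial (-0) - monomial (-1)) * inversion 1 (monomial (-0) - monomial (-1))) := by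
    rw [laplacianPolynomial, doubledLine_isEdgeRepresentatives.laplacianMatrix_eq
      doubledLine_hasCofiniteFreeSymmetry doubledLine_isOrbitRepresentatives, Matrix.det_fin_one,
      Matrix.mul_apply, Fintype.sum_bool]
    simp [incidenceMatrix, two_mul]
  rw [hdet, map_mul, evalTorus_mul_inversion, map_ofNat, norm_mul, Complex.norm_real, map_mul,
    norm_mul, Real.norm_of_nonneg (by positivity), Complex.norm_ofNat]
  ring

end PeriodicGraph

end

theorem corollary3p12 :
    (∀ (d n : ℕ) (α : Type*) (β : Type*) [AddAction (Fin d → ℤ) α] [AddAction (Fin d → ℤ) β]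
      (G : Graph α β) (v : Fin n → α),
      PeriodicGraph.HasCofiniteFreeSymmetry d G →
      PeriodicGraph.IsOrbitRepresentatives d G v →
      PeriodicGraph.laplacianPolynomial d G v ≠ 0 →
      MeasureTheory.IntegrableOn
          (PeriodicGraph.logAbsOnTorus (PeriodicGraph.laplacianPolynomial d G v))
          (Set.Icc (0 : Fin d → ℝ) 1) ∧
        (PeriodicGraph.logMahler (PeriodicGraph.laplacianPolynomial d G v) ≠ 0 →
          Real.log 2 ≤ PeriodicGraph.logMahler (PeriodicGraph.laplacianPolynomial d G v))) ∧
    (PeriodicGraph.HasCofiniteFreeSymmetry 1 PeriodicGraph.doubledLine ∧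
      PeriodicGraph.IsOrbitRepresentatives 1 PeriodicGraph.doubledLine
        (fun _ : Fin 1 => (0 : Fin 1 → ℤ)) ∧
      PeriodicGraph.logMahler (PeriodicGraph.laplacianPolynomial 1 PeriodicGraph.doubledLine
        (fun _ : Fin 1 => (0 : Fin 1 → ℤ))) = Real.log 2) := by
  refine ⟨?_, PeriodicGraph.doubledLine_hasCofiniteFreeSymmetry,
    PeriodicGraph.doubledLine_isOrbitRepresentatives, PeriodicGraph.logMahler_doubledLine⟩
  intro d n α β _ _ G v hG hv hne
  obtain ⟨m, r, i, j, s, t, hr⟩ := PeriodicGraph.exists_isEdgeRepresentatives hG hv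
  rw [PeriodicGraph.laplacianPolynomial, hr.laplacianMatrix_eq hG hv] at hne ⊢
  obtain ⟨hint, hmahler⟩ := PeriodicGraph.logMahler_det_incidenceMatrix_mul hne
  exact ⟨hint, hmahler.resolve_left⟩
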